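/- All graphs are finite and simple. A \emph{drawing} of a graph maps its vertices to distinct points of the plane and its edges to simple curves that connect the points of their ends and contain no other vertex point. A \emph{crossing} is a common point of two distinct edge curves other than a common end point. A drawing is \emph{good} if any two edges cross at most once, adjacent edges do not cross, and no crossing point is common to three or more edges. The \emph{planarization} of a good drawing is the plane graph obtained by turning every crossing into a new vertex. Let $X$ be a vertex cover of a graph $G$. Two vertices $x,y\notin X$ of a good drawing of an induced subgraph of $G$ containing $X$ are in the same \emph{topological cluster} if they have the same neighbours in $X$ and these neighbours occur in the same clockwise cyclic order around $x$ and around $y$ in the drawing. An \emph{abstract topological clustering} of $G$ with respect to $X$ is a good drawing $C$ of an induced subgraph of $G$ with vertex set $V(C)\supseteq X$ such that every vertex $w\in V(G)\setminus X$ has the same neighbourhood in $G$ as some vertex of $V(C)\setminus X$, and no two distinct vertices of $V(C)\setminus X$ are in the same topological cluster in $C$. Two abstract topological clusterings $C,C'$ of $G$ with respect to $X$ are \emph{combinatorially equivalent} if there is an isomorphism $\varphi$ between the drawn induced subgraphs that fixes every vertex of $X$ and is such that the same pairs of edges (under $\varphi$) cross in $C$ and in $C'$, in the same order of the crossings along each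 edge, and the induced correspondence of the vertices and edges of the planarizations preserves the clockwise cyclic order of the edge ends around every vertex and extends to a bijection between the faces that preserves the unbounded face and the incidences of faces with vertices and with edges. \textbf{Lemma.} There is a constant $c\in\mathbb N$ such that for every graph $G$ and every vertex cover $X$ of $G$ of size $k=|X|$, with $K:=\max(k,2)$: \begin{enumerate} \item every abstract topological clustering of $G$ with respect to $X$ has at most $K^{cK}$ vertices (that is, $k^{O(k)}$ vertices); \item any set of pairwise combinatorially non-equivalent abstract topological clusterings of $G$ with respect to $X$ is finite and has at most $2^{K^{cK}}$ elements (a doubly exponential function of $k$). \end{enumerate} -/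

import Mathlib

/-- A drawing of a simple graph `H` in the plane (identified with `ℂ`): distinct points for the
vertices and, for every edge, a simple curve joining the points of its ends and containing no other
vertex point. The curve of an edge is parametrized once for each of its two orientations (darts),
the two parametrizations being reverse to each other. -/
structure GraphDrawing {U : Type*} (H : SimpleGraph U) where
  /-- the point representing a vertex -/
  pt : U → ℂ
  pt_injective : Function.Injective pt
  /-- the curve of an edge, run through from `d.fst` to `d.snd` -/
  arc : ∀ d : H.Dart, Path (pt d.fst) (pt d.snd)
  arc_symm : ∀ d : H.Dart, arc d.symm = (arc d).symm
  arc_injective : ∀ d : H.Dart, Function.Injective (arc d)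
  pt_mem_arc : ∀ (d : H.Dart) (u : U), pt u ∈ Set.range (arc d) → u = d.fst ∨ u = d.snd

namespace GraphDrawing

variable {U : Type*} {H : SimpleGraph U}

/-- The edges underlying `d` and `e` cross at `z`: they are distinct and `z` is a common point of
their curves other than a common end point. -/
def IsCrossing (D : GraphDrawing H) (d e : H.Dart) (z : ℂ) : Prop :=
  d.edge ≠ e.edge ∧ z ∈ Set.range (D.arc d) ∧ z ∈ Set.range (D.arc e) ∧
    ¬ ∃ u, u ∈ d.edge ∧ u ∈ e.edge ∧ z = D.pt u

/-- Good drawings: two edges cross at most once, adjacent edges do not cross, and no crossing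
point is common to three edges. -/
structure IsGood (D : GraphDrawing H) : Prop where
  crossing_unique : ∀ d e z z', D.IsCrossing d e z → D.IsCrossing d e z' → z = z'
  adjacent_not_crossing : ∀ d e z, D.IsCrossing d e z → ∀ u, ¬ (u ∈ d.edge ∧ u ∈ e.edge)
  no_triple_crossing : ∀ d e f z, D.IsCrossing d e z → D.IsCrossing d f z → e.edge = f.edge

/-- The vertices of the planarization: the vertex points and the crossing points. -/
def nodes (D : GraphDrawing H) : Set ℂ :=
  {z | (∃ u, z = D.pt u) ∨ ∃ d e, D.IsCrossing d e z}

/-- `w` comes strictly before `z` on the curve of `d`, run through from `d.fst` to `d.snd`. -/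
def Precedes (D : GraphDrawing H) (d : H.Dart) (w z : ℂ) : Prop :=
  ∃ s t : unitInterval, s < t ∧ D.arc d s = w ∧ D.arc d t = z

/-- The open piece of the curve of `d` between its points `w` and `z`. -/
def openSegment (D : GraphDrawing H) (d : H.Dart) (w z : ℂ) : Set ℂ :=
  {y | D.Precedes d w y ∧ D.Precedes d y z}

/-- The piece of `d` from `w` to `z` is an edge of the planarization: `w` and `z` are consecutive
nodes along `d`. -/
def IsSegment (D : GraphDrawing H) (d : H.Dart) (w z : ℂ) : Prop :=
  w ∈ D.nodes ∧ z ∈ D.nodes ∧ D.Precedes d w z ∧ Disjoint (D.openSegment d w z) D.nodes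

/-- The set of all points covered by the drawing. -/
def support (D : GraphDrawing H) : Set ℂ :=
  Set.range D.pt ∪ ⋃ d, Set.range (D.arc d)

/-- The faces of the planarization: the connected components of the complement of the drawing. -/
def faces (D : GraphDrawing H) : Set (Set ℂ) :=
  {F | ∃ z ∈ (D.support)ᶜ, F = connectedComponentIn (D.support)ᶜ z}

/-- The dart `d` runs through (or starts at) `z` and continues from there towards the point of
`d.snd`. The darts leaving a node correspond to the half-edges of the planarization at it: at a
vertex point they are the darts starting at the vertex, at a crossing point they are the two
orientations of each of the two crossing edges. -/
def Leaves (D : GraphDrawing H) (d : H.Dart) (z : ℂ) : Prop :=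
  z ∈ Set.range (D.arc d) ∧ z ≠ D.pt d.snd

/-- `w` is the point where `d`, followed from `z` on, first meets the circle of radius `r`
about `z`. -/
def IsExit (D : GraphDrawing H) (d : H.Dart) (z : ℂ) (r : ℝ) (w : ℂ) : Prop :=
  ∃ s t : unitInterval, s < t ∧ D.arc d s = z ∧ D.arc d t = w ∧ dist w z = r ∧
    ∀ q, s ≤ q → q < t → dist (D.arc d q) z < r

/-- A radius so small that every curve leaving `z` meets the circle about `z` before it ends. -/
def AdmissibleRadius (D : GraphDrawing H) (z : ℂ) (r : ℝ) : Prop :=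
  0 < r ∧ ∀ d, D.Leaves d z → r < dist z (D.pt d.snd)

/-- The darts `d`, `e`, `f` leaving `z` first meet the circle of radius `r` about `z` in three
points that occur in this clockwise cyclic order. (The cyclic order of `Real.Angle` is
counterclockwise.) -/
def Clockwise (D : GraphDrawing H) (z : ℂ) (r : ℝ) (d e f : H.Dart) : Prop :=
  ∃ a b c : ℂ, D.IsExit d z r a ∧ D.IsExit e z r b ∧ D.IsExit f z r c ∧
    sbtw ((c - z).arg : Real.Angle) ((b - z).arg : Real.Angle) ((a - z).arg : Real.Angle)

/-- The vertices `x` and `y` outside `X` belong to the same topological cluster: they have the same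
neighbours in `X`, and these occur in the same clockwise cyclic order around `x` and around `y`.
In a good drawing the cyclic order around a vertex does not depend on the admissible radius at
which it is read off. -/
def SameCluster (D : GraphDrawing H) (X : Set U) (x y : U) : Prop :=
  x ∉ X ∧ y ∉ X ∧ (∀ a ∈ X, H.Adj x a ↔ H.Adj y a) ∧
    ∃ r r' : ℝ, D.AdmissibleRadius (D.pt x) r ∧ D.AdmissibleRadius (D.pt y) r' ∧
      ∀ a ∈ X, ∀ b ∈ X, ∀ c ∈ X,
        ∀ (xa : H.Adj x a) (xb : H.Adj x b) (xc : H.Adj x c)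
          (ya : H.Adj y a) (yb : H.Adj y b) (yc : H.Adj y c),
          (D.Clockwise (D.pt x) r ⟨(x, a), xa⟩ ⟨(x, b), xb⟩ ⟨(x, c), xc⟩ ↔
            D.Clockwise (D.pt y) r' ⟨(y, a), ya⟩ ⟨(y, b), yb⟩ ⟨(y, c), yc⟩)

/-- The drawings `D` and `D'` are combinatorially equivalent along the graph isomorphism `φ`:
there are bijections `β` between the vertices and `ψ` between the faces of their planarizations,
where `β` extends `φ` and matches the crossings of corresponding pairs of edges, the order of the
nodes along every edge and the clockwise order around every node are preserved, and `ψ` preserves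
the unbounded face and the incidences of faces with vertices and with edges of the
planarizations. -/
def CombEquiv {U' : Type*} {H' : SimpleGraph U'} (φ : H ≃g H')
    (D : GraphDrawing H) (D' : GraphDrawing H') : Prop :=
  ∃ (β : D.nodes ≃ D'.nodes) (ψ : D.faces ≃ D'.faces),
    (∀ (z : D.nodes) (u : U), (z : ℂ) = D.pt u ↔ (β z : ℂ) = D'.pt (φ u)) ∧
    (∀ (z : D.nodes) (d e : H.Dart), D.IsCrossing d e z ↔
      D'.IsCrossing (φ.toHom.mapDart d) (φ.toHom.mapDart e) (β z)) ∧
    (∀ (d : H.Dart) (w z : D.nodes), D.Precedes d w z ↔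
      D'.Precedes (φ.toHom.mapDart d) (β w) (β z)) ∧
    (∀ z : D.nodes, ∃ r r' : ℝ, D.AdmissibleRadius z r ∧ D'.AdmissibleRadius (β z) r' ∧
      ∀ d e f : H.Dart, D.Leaves d z → D.Leaves e z → D.Leaves f z →
        (D.Clockwise z r d e f ↔ D'.Clockwise (β z) r'
          (φ.toHom.mapDart d) (φ.toHom.mapDart e) (φ.toHom.mapDart f))) ∧
    (∀ F : D.faces, Bornology.IsBounded (F : Set ℂ) ↔ Bornology.IsBounded (ψ F : Set ℂ)) ∧
    (∀ (F : D.faces) (z : D.nodes),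
      (z : ℂ) ∈ frontier (F : Set ℂ) ↔ (β z : ℂ) ∈ frontier (ψ F : Set ℂ)) ∧
    (∀ (F : D.faces) (d : H.Dart) (w z : D.nodes), D.IsSegment d w z →
      (D.openSegment d w z ⊆ frontier (F : Set ℂ) ↔
        D'.openSegment (φ.toHom.mapDart d) (β w) (β z) ⊆ frontier (ψ F : Set ℂ)))

end GraphDrawing

/-- An abstract topological clustering of `G` with respect to the vertex cover `X`: a good drawing
of an induced subgraph of `G` containing `X`, such that every vertex of `G` outside `X` has the same
neighbourhood as some vertex of the subgraph outside `X`, and no two vertices of the subgraph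
outside `X` are in the same topological cluster of the drawing. -/
structure AbstractClustering {V : Type*} (G : SimpleGraph V) (X : Set V) where
  /-- the vertices of the induced subgraph that is drawn -/
  verts : Set V
  /-- the drawing -/
  drawing : GraphDrawing (G.induce verts)
  isGood : drawing.IsGood
  subset_verts : X ⊆ verts
  exists_neighborSet_eq : ∀ w ∉ X, ∃ t ∈ verts, t ∉ X ∧ G.neighborSet t = G.neighborSet w
  eq_of_sameCluster : ∀ s t : verts, drawing.SameCluster (Subtype.val ⁻¹' X) s t → s = t

namespace AbstractClustering

variable {V : Type*} {G : SimpleGraph V} {X : Set V}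

/-- Combinatorial equivalence of abstract topological clusterings: the drawings are combinatorially
equivalent along an isomorphism of the drawn subgraphs that fixes `X` pointwise. -/
def Equivalent (C C' : AbstractClustering G X) : Prop :=
  ∃ φ : G.induce C.verts ≃g G.induce C'.verts,
    (∀ v : C.verts, (v : V) ∈ X → (φ v : V) = v) ∧
    GraphDrawing.CombEquiv φ C.drawing C'.drawing

end AbstractClustering

/-! The first bound counts clusters. Up to the choice of admissible radii, the cluster of a vertex
is determined by its neighbours in `X`, by which of their curves reach the chosen circle, and by the
ranking of the exit directions. This gives at most `2 ^ k * 2 ^ k * k ^ k` possibilities, hence at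
most `K ^ (4 * K)` vertices together with `X`.

For the second bound, a good drawing on at most `n` vertices has polynomially many nodes and faces.
All data compared by `CombEquiv` are therefore finitely many relations of bounded arity on numbers
below `n ^ 12`. There are at most `2 ^ n ^ 96` such codes, and drawings with equal codes are
equivalent.

Counting faces is the topological core, and it uses logarithms in place of Euler's formula. If
points `p i` lie in distinct bounded components of the complement of a compact set, no nontrivial
product of powers of the functions `z - p i` has a continuous logarithm on that set
(`eq_zero_of_exp_eq_prod_zpow`). On a single vertex point or edge curve each `z - p i` does have
one, and two of these logarithms differ at a common point by an integer multiple of `2πi`. A linear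
relation between the resulting integer vectors would let the local logarithms be glued, so the
vectors are independent and their number is at most the rank (`card_le_of_bounded_components`). -/

/-! ### Continuous logarithms and components of plane complements -/

/-- A nowhere vanishing continuous function on a simply connected, locally path connected space has
a continuous logarithm. -/
theorem ContinuousMap.exists_exp_eq {A : Type*} [TopologicalSpace A] [SimplyConnectedSpace A]
    [LocallyPathConnectedSpace A] (f : C(A, ℂ)) (hf : ∀ a, f a ≠ 0) :
    ∃ g : C(A, ℂ), ∀ a, Complex.exp (g a) = f a := by
  have a₀ : A := Classical.arbitrary A
  obtain ⟨g, ⟨-, hg⟩, -⟩ := Complex.isCoveringMapOn_exp.existsUnique_continuousMap_lifts f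
    (Complex.exp_log (hf a₀)) (fun a => hf a)
  exact ⟨g, fun a => congrFun hg a⟩

/-- A nowhere vanishing continuous function on the plane that agrees with `(z - p) ^ n` on a circle
about `p` has winding number zero there. -/
theorem zpow_eq_zero_of_extends {n : ℤ} {p : ℂ} {R : ℝ} (hR : 0 < R) {h : ℂ → ℂ}
    (hc : Continuous h) (h0 : ∀ z, h z ≠ 0) (hn : ∀ z, dist z p = R → h z = (z - p) ^ n) :
    n = 0 := by
  obtain ⟨g, hg⟩ := ContinuousMap.exists_exp_eq ⟨h, hc⟩ h0
  simp only [ContinuousMap.coe_mk] at hg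
  let γ : C(ℝ, ℂ) := ⟨fun θ => p + R * Complex.exp (θ * Complex.I), by fun_prop⟩
  have hγ : ∀ θ, h (γ θ) = (R : ℂ) ^ n * Complex.exp (n * (θ * Complex.I)) := by
    intro θ
    rw [hn]
    · simp [γ, mul_zpow, ← Complex.exp_int_mul]
    · simp [γ, dist_eq_norm, abs_of_pos hR, Complex.norm_exp_ofReal_mul_I]
  have hγ0 : h (γ 0) = (R : ℂ) ^ n := by simp [hγ]
  -- Both `g ∘ γ` and `g (γ 0) + n * (θ * I)` lift `h ∘ γ` through `exp` from the same starting
  -- value. Since `γ` closes up at `2π`, their equality there forces `n * (2πi) = 0`.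
  have key := (Complex.isCoveringMapOn_exp.existsUnique_continuousMap_lifts
    (⟨fun θ => h (γ θ), by fun_prop⟩ : C(ℝ, ℂ)) (a₀ := 0) (e₀ := g (γ 0))
    (hg _) (fun a => h0 _)).unique
    (y₁ := ⟨fun θ => g (γ θ), by fun_prop⟩)
    (y₂ := ⟨fun θ => g (γ 0) + n * (θ * Complex.I), by fun_prop⟩)
    ⟨rfl, funext fun θ => hg _⟩
    ⟨by simp, funext fun θ => by simp [Complex.exp_add, hg, hγ]⟩
  have h1 := DFunLike.congr_fun key (2 * Real.pi)
  have h2 : γ (2 * Real.pi) = γ 0 := by simp [γ]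
  simp only [ContinuousMap.coe_mk, h2] at h1
  simpa using h1

/-- A frontier point outside `K` would have its own component as an open neighbourhood. This meets
the given component, hence equals it, but an open set contains none of its frontier points. -/
theorem IsClosed.frontier_connectedComponentIn_compl_subset {K : Set ℂ} (hK : IsClosed K) (z : ℂ) :
    frontier (connectedComponentIn Kᶜ z) ⊆ K := by
  intro y hy
  by_contra hyK
  have ho : IsOpen (connectedComponentIn Kᶜ z) := hK.isOpen_compl.connectedComponentIn
  rw [ho.frontier_eq] at hy
  have ho' : IsOpen (connectedComponentIn Kᶜ y) := hK.isOpen_compl.connectedComponentIn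
  have hyy : y ∈ connectedComponentIn Kᶜ y := mem_connectedComponentIn hyK
  obtain ⟨w, hw, hw'⟩ := mem_closure_iff.1 hy.1 _ ho' hyy
  have e := (connectedComponentIn_eq hw).trans (connectedComponentIn_eq hw').symm
  exact hy.2 (by rw [← e]; exact hyy)

/-- Eilenberg's criterion: if the points `p i` lie in distinct bounded components of the complement
of a compact plane set `K`, then a product of powers of the functions `z - p i` has a continuous
logarithm on `K` only if all exponents vanish. -/
theorem eq_zero_of_exp_eq_prod_zpow {ι : Type*} [Fintype ι] {K : Set ℂ} (hK : IsCompact K)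
    {p : ι → ℂ} (hp : ∀ i, p i ∉ K)
    (hb : ∀ i, Bornology.IsBounded (connectedComponentIn Kᶜ (p i)))
    (hinj : Function.Injective fun i => connectedComponentIn Kᶜ (p i))
    {n : ι → ℤ} {g : ℂ → ℂ} (hg : ContinuousOn g K)
    (h : ∀ z ∈ K, Complex.exp (g z) = ∏ i, (z - p i) ^ n i) (i : ι) : n i = 0 := by
  classical
  set U := connectedComponentIn Kᶜ (p i) with hU
  have ho : IsOpen U := hK.isClosed.isOpen_compl.connectedComponentIn
  have hfr : frontier U ⊆ K := hK.isClosed.frontier_connectedComponentIn_compl_subset _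
  have hpU : p i ∈ U := mem_connectedComponentIn (hp i)
  have hcl : ∀ j, j ≠ i → p j ∉ closure U := by
    intro j hj hc
    rcases closure_eq_self_union_frontier U ▸ hc with hc | hc
    · exact hj (hinj (connectedComponentIn_eq hc).symm)
    · exact hp j (hfr hc)
  -- Tietze extension of the logarithm from `K` to the plane.
  obtain ⟨G, hG⟩ := ContinuousMap.exists_restrict_eq hK.isClosed
    ⟨K.domRestrict g, continuousOn_iff_continuous_domRestrict.1 hg⟩
  have hGg : ∀ z ∈ K, G z = g z := fun z hz => DFunLike.congr_fun hG ⟨z, hz⟩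
  obtain ⟨R, hR0, hR⟩ : ∃ R > 0, U ⊆ Metric.ball (p i) R := by
    obtain ⟨R, hR⟩ := (hb i).subset_ball (p i)
    exact ⟨max R 1, by positivity, hR.trans (Metric.ball_subset_ball (le_max_left _ _))⟩
  have hprod : ∀ z ∈ closure U, ∏ j ∈ Finset.univ.erase i, (z - p j) ^ n j ≠ 0 := by
    intro z hz
    refine Finset.prod_ne_zero_iff.2 fun j hj => zpow_ne_zero _ (sub_ne_zero.2 ?_)
    rintro rfl
    exact hcl j (Finset.ne_of_mem_erase hj) hz
  -- On `U` the function `(z - p i) ^ n i` is replaced by `exp G` divided by the other factors,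
  -- which removes its singularity at `p i`. The two definitions agree on the frontier of `U`, which
  -- lies in `K`, and the circle of radius `R` lies outside `U`.
  refine zpow_eq_zero_of_extends hR0 (p := p i) (h := U.piecewise
    (fun z => Complex.exp (G z) / ∏ j ∈ Finset.univ.erase i, (z - p j) ^ n j)
    (fun z => (z - p i) ^ n i)) (continuous_piecewise ?_ ?_ ?_) ?_ ?_
  · intro z hz
    rw [hGg z (hfr hz), h z (hfr hz), ← Finset.mul_prod_erase _ _ (Finset.mem_univ i),
      mul_div_cancel_right₀ _ (hprod z (frontier_subset_closure hz))]
  · refine ContinuousOn.div (by fun_prop) ?_ hprod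
    refine continuousOn_finsetProd _ fun j hj => ContinuousOn.zpow₀ (by fun_prop) _ ?_
    intro z hz
    refine Or.inl (sub_ne_zero.2 ?_)
    rintro rfl
    exact hcl j (Finset.ne_of_mem_erase hj) hz
  · rw [ho.isClosed_compl.closure_eq]
    refine ContinuousOn.zpow₀ (by fun_prop) _ fun z hz => Or.inl (sub_ne_zero.2 ?_)
    rintro rfl
    exact hz hpU
  · intro z
    by_cases hz : z ∈ U
    · rw [Set.piecewise_eq_of_mem _ _ _ hz]
      exact div_ne_zero (Complex.exp_ne_zero _) (hprod z (subset_closure hz))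
    · rw [Set.piecewise_eq_of_notMem _ _ _ hz]
      refine zpow_ne_zero _ (sub_ne_zero.2 ?_)
      rintro rfl
      exact hz hpU
  · intro z hz
    refine Set.piecewise_eq_of_notMem _ _ _ fun hzU => ?_
    have := hR hzU
    rw [Metric.mem_ball, hz] at this
    exact lt_irrefl _ this

/-- A plane set on which every nowhere vanishing continuous function has a continuous logarithm. -/
def HasContinuousLogs (A : Set ℂ) : Prop :=
  ∀ f : ℂ → ℂ, ContinuousOn f A → (∀ z ∈ A, f z ≠ 0) →
    ∃ g : ℂ → ℂ, ContinuousOn g A ∧ ∀ z ∈ A, Complex.exp (g z) = f z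

/-- If a compact plane set is a finite union of closed sets with continuous logarithms, any two of
which meet only in points of a finite set `T`, then the number of bounded components of its
complement is bounded. -/
theorem card_le_of_bounded_components {ι J : Type*} [Fintype ι] [Fintype J] {A : J → Set ℂ}
    (hA : ∀ j, IsCompact (A j)) (hlog : ∀ j, HasContinuousLogs (A j)) (T : Finset ℂ)
    (hT : ∀ j j', j ≠ j' → A j ∩ A j' ⊆ T) {p : ι → ℂ} (hp : ∀ i, p i ∉ ⋃ j, A j)
    (hb : ∀ i, Bornology.IsBounded (connectedComponentIn (⋃ j, A j)ᶜ (p i)))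
    (hinj : Function.Injective fun i => connectedComponentIn (⋃ j, A j)ᶜ (p i)) :
    Fintype.card ι ≤ T.card * (Fintype.card J * Fintype.card J) := by
  classical
  have hne : ∀ i j, ∀ z ∈ A j, z - p i ≠ 0 := by
    intro i j z hz
    refine sub_ne_zero.2 ?_
    rintro rfl
    exact hp i (Set.mem_iUnion_of_mem j hz)
  choose L hLc hL using fun i j => hlog j (fun z => z - p i) (by fun_prop) (hne i j)
  -- The integer is the discrepancy of the two logarithms at a common point; it is set to `0` for
  -- triples where the point is not common.
  have hint : ∀ i (t : T × (J × J)), ∃ m : ℤ, (t.1 : ℂ) ∈ A t.2.1 ∩ A t.2.2 →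
      L i t.2.1 t.1 = L i t.2.2 t.1 + m * (2 * Real.pi * Complex.I) := by
    intro i t
    by_cases ht : (t.1 : ℂ) ∈ A t.2.1 ∩ A t.2.2
    · obtain ⟨m, hm⟩ := Complex.exp_eq_exp_iff_exists_int.1
        ((hL i t.2.1 _ ht.1).trans (hL i t.2.2 _ ht.2).symm)
      exact ⟨m, fun _ => hm⟩
    · exact ⟨0, fun h => absurd h ht⟩
  choose c hc using hint
  have hli : LinearIndependent ℤ c := by
    rw [Fintype.linearIndependent_iff]
    intro n hn
    -- `S j` is a logarithm of the product of the `(z - p i) ^ n i` on `A j`. The linear relation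
    -- `hn` says exactly that the discrepancies cancel, so the `S j` glue.
    let S : J → ℂ → ℂ := fun j z => ∑ i, n i * L i j z
    have hS : ∀ j j', ∀ z ∈ A j ∩ A j', S j z = S j' z := by
      intro j j' z hz
      rcases eq_or_ne j j' with rfl | hjj
      · rfl
      have hzT := hT j j' hjj hz
      let t : T × (J × J) := (⟨z, hzT⟩, j, j')
      have h0 : ∑ i, (n i : ℂ) * c i t = 0 := by
        have := congrFun hn t
        simp only [Finset.sum_apply, Pi.smul_apply, smul_eq_mul, Pi.zero_apply] at this
        exact_mod_cast this
      calc S j z = ∑ i, (n i * L i j' z + n i * c i t * (2 * Real.pi * Complex.I)) :=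
            Finset.sum_congr rfl fun i _ => by rw [hc i t hz]; ring
        _ = S j' z := by rw [Finset.sum_add_distrib, ← Finset.sum_mul, h0, zero_mul, add_zero]
    let g : ℂ → ℂ := fun z => if h : ∃ j, z ∈ A j then S h.choose z else 0
    have hgS : ∀ j, ∀ z ∈ A j, g z = S j z := by
      intro j z hz
      have h : ∃ j, z ∈ A j := ⟨j, hz⟩
      simp only [g, dif_pos h]
      exact hS _ _ _ ⟨h.choose_spec, hz⟩
    refine eq_zero_of_exp_eq_prod_zpow (isCompact_iUnion hA) hp hb hinj (g := g) ?_ ?_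
    · refine (locallyFinite_of_finite A).continuousOn_iUnion (fun j => (hA j).isClosed) fun j => ?_
      refine ContinuousOn.congr ?_ (hgS j)
      exact continuousOn_finsetSum _ fun i _ => continuousOn_const.mul (hLc i j)
    · intro z hz
      obtain ⟨j, hj⟩ := Set.mem_iUnion.1 hz
      rw [hgS j z hj, Complex.exp_sum]
      exact Finset.prod_congr rfl fun i _ => by rw [Complex.exp_int_mul, hL i j z hj]
  simpa using hli.fintype_card_le_finrank

theorem hasContinuousLogs_singleton (z : ℂ) : HasContinuousLogs {z} := fun f _ h0 =>
  ⟨fun _ => Complex.log (f z), continuousOn_const, by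
    rintro w rfl
    exact Complex.exp_log (h0 _ rfl)⟩

/-- The curve is an embedding of the interval, which is simply connected, so a logarithm found on
the interval transfers to the image. -/
theorem hasContinuousLogs_range_of_injective {γ : unitInterval → ℂ} (hγ : Continuous γ)
    (hinj : Function.Injective γ) : HasContinuousLogs (Set.range γ) := by
  intro f hf h0
  have : SimplyConnectedSpace unitInterval := by
    have : ContractibleSpace unitInterval :=
      (convex_Icc (0 : ℝ) 1).contractibleSpace ⟨0, by simp⟩
    infer_instance
  have : LocallyPathConnectedSpace unitInterval := (convex_Icc (0 : ℝ) 1).locallyPathConnectedSpace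
  obtain ⟨g, hg⟩ := ContinuousMap.exists_exp_eq (A := unitInterval)
    ⟨fun t => f (γ t), hf.comp_continuous hγ fun t => ⟨t, rfl⟩⟩ fun t => h0 _ ⟨t, rfl⟩
  have hemb := (hγ.isClosedEmbedding hinj).isEmbedding
  have hinv : ∀ t, Function.invFun γ (γ t) = t := Function.leftInverse_invFun hinj
  refine ⟨fun z => g (Function.invFun γ z), ?_, ?_⟩
  · rw [continuousOn_iff_continuous_domRestrict]
    convert! g.continuous.comp hemb.toHomeomorph.symm.continuous using 1
  · rintro _ ⟨t, rfl⟩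
    simp only [hinv]
    exact hg t

/-- The exterior of the disc is the image of a convex half-plane under `exp`. -/
theorem Complex.isPreconnected_compl_closedBall {R : ℝ} (hR : 0 < R) :
    IsPreconnected (Metric.closedBall (0 : ℂ) R)ᶜ := by
  have h : (Metric.closedBall (0 : ℂ) R)ᶜ = Complex.exp '' {z | Real.log R < z.re} := by
    ext z
    simp only [Set.mem_compl_iff, mem_closedBall_zero_iff, not_le, Set.mem_image]
    constructor
    · intro hz
      have hz0 : z ≠ 0 := norm_pos_iff.1 (hR.trans hz)
      exact ⟨Complex.log z, by simpa [Complex.log_re] using Real.log_lt_log hR hz,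
        Complex.exp_log hz0⟩
    · rintro ⟨w, hw, rfl⟩
      rwa [Complex.norm_exp, ← Real.log_lt_iff_lt_exp hR]
  rw [h]
  exact (convex_halfSpace_re_gt _).isPreconnected.image _ Complex.continuous_exp.continuousOn

/-- The complement of a compact plane set has at most one unbounded component. -/
theorem IsCompact.connectedComponentIn_compl_eq_of_not_isBounded {K : Set ℂ} (hK : IsCompact K)
    {z w : ℂ} (hz : ¬ Bornology.IsBounded (connectedComponentIn Kᶜ z))
    (hw : ¬ Bornology.IsBounded (connectedComponentIn Kᶜ w)) :
    connectedComponentIn Kᶜ z = connectedComponentIn Kᶜ w := by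
  obtain ⟨R, hR, hKR⟩ := hK.isBounded.subset_closedBall_lt 0 0
  have key : ∀ z, ¬ Bornology.IsBounded (connectedComponentIn Kᶜ z) →
      (Metric.closedBall (0 : ℂ) R)ᶜ ⊆ connectedComponentIn Kᶜ z := by
    intro z hz
    obtain ⟨y, hy, hyR⟩ := Set.not_subset.1 fun h => hz (Metric.isBounded_closedBall.subset h)
    rw [connectedComponentIn_eq hy]
    exact (Complex.isPreconnected_compl_closedBall hR).subset_connectedComponentIn hyR
      (Set.compl_subset_compl.2 hKR)
  obtain ⟨y, hy⟩ : ((Metric.closedBall (0 : ℂ) R)ᶜ).Nonempty :=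
    ⟨((R + 1 : ℝ) : ℂ), by
      rw [Set.mem_compl_iff, mem_closedBall_zero_iff, Complex.norm_real, not_le]
      exact (lt_add_one R).trans_le (le_abs_self _)⟩
  rw [connectedComponentIn_eq (key z hz hy), connectedComponentIn_eq (key w hw hy)]

/-! ### Counting nodes and faces of a good drawing -/

namespace GraphDrawing

variable {U : Type*} {H : SimpleGraph U}

theorem finite_dart [Finite U] : Finite H.Dart :=
  Finite.of_injective _ SimpleGraph.Dart.toProd_injective

theorem card_dart_le [Finite U] : Nat.card H.Dart ≤ Nat.card U * Nat.card U := by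
  rw [← Nat.card_prod]
  exact Nat.card_le_card_of_injective _ SimpleGraph.Dart.toProd_injective

theorem exists_admissibleRadius [Finite U] (D : GraphDrawing H) (z : ℂ) :
    ∃ r, D.AdmissibleRadius z r := by
  have := finite_dart (H := H)
  have h : ∀ᶠ r in nhdsWithin (0 : ℝ) (Set.Ioi 0), ∀ d, D.Leaves d z → r < dist z (D.pt d.snd) := by
    refine Filter.eventually_all.2 fun d => ?_
    by_cases hd : D.Leaves d z
    · filter_upwards [Ioo_mem_nhdsGT (dist_pos.2 hd.2)] with r hr _ using hr.2
    · exact Filter.Eventually.of_forall fun r h => absurd h hd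
  obtain ⟨r, hr0, hr⟩ := (eventually_mem_nhdsWithin.and h).exists
  exact ⟨r, hr0, hr⟩

theorem range_arc_eq_of_edge_eq (D : GraphDrawing H) {d e : H.Dart} (h : d.edge = e.edge) :
    Set.range (D.arc d) = Set.range (D.arc e) := by
  rcases SimpleGraph.dart_edge_eq_iff d e |>.1 h with rfl | rfl
  · rfl
  · exact (congrArg (fun p : Path (D.pt e.snd) (D.pt e.fst) => Set.range p)
      (D.arc_symm e)).trans (Path.symm_range _)

theorem mem_nodes_of_mem_arcs (D : GraphDrawing H) {d e : H.Dart} (h : d.edge ≠ e.edge) {z : ℂ}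
    (hd : z ∈ Set.range (D.arc d)) (he : z ∈ Set.range (D.arc e)) : z ∈ D.nodes := by
  by_cases hu : ∃ u, u ∈ d.edge ∧ u ∈ e.edge ∧ z = D.pt u
  · obtain ⟨u, -, -, hz⟩ := hu
    exact Or.inl ⟨u, hz⟩
  · exact Or.inr ⟨d, e, h, hd, he, hu⟩

/-- Each node is labelled by a vertex or by a pair of crossing darts; two edges cross at most once,
so the label determines the node. -/
theorem IsGood.finite_nodes_and_card_le [Finite U] {D : GraphDrawing H} (hD : D.IsGood) :
    Finite D.nodes ∧ Nat.card D.nodes ≤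
      Nat.card U + (Nat.card U * Nat.card U) * (Nat.card U * Nat.card U) := by
  have := finite_dart (H := H)
  have hex : ∀ z : D.nodes, ∃ c : U ⊕ (H.Dart × H.Dart),
      Sum.elim (fun u => (z : ℂ) = D.pt u) (fun p => D.IsCrossing p.1 p.2 z) c := by
    rintro ⟨z, ⟨u, hu⟩ | ⟨d, e, h⟩⟩
    · exact ⟨Sum.inl u, hu⟩
    · exact ⟨Sum.inr (d, e), h⟩
  choose c hc using hex
  have hinj : Function.Injective c := by
    intro z w h
    have hz := hc z
    have hw := hc w
    rw [h] at hz
    generalize c w = x at hz hw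
    rcases x with u | p
    · exact Subtype.ext (hz.trans hw.symm)
    · exact Subtype.ext (hD.crossing_unique _ _ _ _ hz hw)
  refine ⟨Finite.of_injective c hinj, (Nat.card_le_card_of_injective c hinj).trans ?_⟩
  rw [Nat.card_sum, Nat.card_prod]
  gcongr <;> exact card_dart_le

/-- The vertex points and the edge curves of a drawing, as point sets. -/
def pieces (D : GraphDrawing H) : Set (Set ℂ) :=
  Set.range (fun u => {D.pt u}) ∪ Set.range fun d => Set.range (D.arc d)

theorem iUnion_pieces (D : GraphDrawing H) : ⋃ A : D.pieces, (A : Set ℂ) = D.support := by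
  rw [← Set.sUnion_eq_iUnion, pieces, Set.sUnion_union, Set.sUnion_range, Set.sUnion_range,
    Set.iUnion_singleton_eq_range]
  rfl

theorem finite_pieces [Finite U] (D : GraphDrawing H) : D.pieces.Finite := by
  have := finite_dart (H := H)
  exact (Set.finite_range _).union (Set.finite_range _)

theorem card_pieces_le [Finite U] (D : GraphDrawing H) :
    Nat.card D.pieces ≤ Nat.card U + Nat.card U * Nat.card U := by
  have := finite_dart (H := H)
  refine (Set.ncard_union_le _ _).trans (add_le_add ?_ (le_trans ?_ (card_dart_le (H := H)))) <;>
  · rw [← Set.image_univ, ← Set.ncard_univ]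
    exact Set.ncard_image_le Set.finite_univ

theorem isCompact_of_mem_pieces {D : GraphDrawing H} {A : Set ℂ} (hA : A ∈ D.pieces) :
    IsCompact A := by
  rcases hA with ⟨u, rfl⟩ | ⟨d, rfl⟩
  · exact isCompact_singleton
  · exact isCompact_range (D.arc d).continuous

theorem hasContinuousLogs_of_mem_pieces {D : GraphDrawing H} {A : Set ℂ} (hA : A ∈ D.pieces) :
    HasContinuousLogs A := by
  rcases hA with ⟨u, rfl⟩ | ⟨d, rfl⟩
  · exact hasContinuousLogs_singleton _
  · exact hasContinuousLogs_range_of_injective (D.arc d).continuous (D.arc_injective d)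

/-- Both orientations of an edge give the same point set, so different arcs among the pieces come
from different edges. -/
theorem inter_subset_nodes {D : GraphDrawing H} {A B : Set ℂ} (hA : A ∈ D.pieces)
    (hB : B ∈ D.pieces) (hAB : A ≠ B) : A ∩ B ⊆ D.nodes := by
  rintro z ⟨hzA, hzB⟩
  rcases hA with ⟨u, rfl⟩ | ⟨d, rfl⟩
  · exact Or.inl ⟨u, hzA⟩
  rcases hB with ⟨u, rfl⟩ | ⟨e, rfl⟩
  · exact Or.inl ⟨u, hzB⟩
  exact D.mem_nodes_of_mem_arcs (fun h => hAB (D.range_arc_eq_of_edge_eq h)) hzA hzB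

theorem isCompact_support [Finite U] (D : GraphDrawing H) : IsCompact D.support := by
  have := D.finite_pieces.to_subtype
  rw [← D.iUnion_pieces]
  exact isCompact_iUnion fun A => isCompact_of_mem_pieces A.2

/-- The number of faces of a good drawing is polynomially bounded. -/
theorem IsGood.finite_faces_and_card_le [Finite U] {D : GraphDrawing H} (hD : D.IsGood) :
    Finite D.faces ∧ Nat.card D.faces ≤
      1 + Nat.card D.nodes * (Nat.card D.pieces * Nat.card D.pieces) := by
  classical
  have := D.finite_pieces.to_subtype
  have := Fintype.ofFinite D.pieces
  have hnod : D.nodes.Finite := Set.finite_coe_iff.1 hD.finite_nodes_and_card_le.1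
  -- The bound is proved for every finite set of bounded faces, so that it also yields finiteness.
  have hbdd : ∀ s : Finset (Set ℂ), (s : Set (Set ℂ)) ⊆ {F ∈ D.faces | Bornology.IsBounded F} →
      s.card ≤ Nat.card D.nodes * (Nat.card D.pieces * Nat.card D.pieces) := by
    intro s hs
    choose p hp hF using fun F : s => (hs F.2).1
    have h := card_le_of_bounded_components (ι := s) (A := fun A : D.pieces => (A : Set ℂ))
      (fun A => isCompact_of_mem_pieces A.2) (fun A => hasContinuousLogs_of_mem_pieces A.2)
      hnod.toFinset
      (fun A B hAB => by
        rw [Set.Finite.coe_toFinset]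
        exact inter_subset_nodes A.2 B.2 fun h => hAB (Subtype.ext h))
      (p := p) (by rw [D.iUnion_pieces]; exact hp)
      (by rw [D.iUnion_pieces]; intro F; rw [← hF F]; exact (hs F.2).2)
      (by
        rw [D.iUnion_pieces]
        intro F F' h
        exact Subtype.ext ((hF F).trans (h.trans (hF F').symm)))
    rwa [Fintype.card_coe, ← Nat.card_eq_fintype_card, ← Set.ncard_eq_toFinset_card _ hnod] at h
  have hfin : {F ∈ D.faces | Bornology.IsBounded F}.Finite := by
    by_contra hinf
    obtain ⟨s, hs, hc⟩ := Set.Infinite.exists_subset_card_eq hinf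
      (Nat.card D.nodes * (Nat.card D.pieces * Nat.card D.pieces) + 1)
    have := hbdd s hs
    omega
  have hsub : {F ∈ D.faces | ¬ Bornology.IsBounded F}.Subsingleton := by
    rintro _ ⟨⟨z, -, rfl⟩, hz⟩ _ ⟨⟨w, -, rfl⟩, hw⟩
    exact D.isCompact_support.connectedComponentIn_compl_eq_of_not_isBounded hz hw
  have hun : D.faces = {F ∈ D.faces | ¬ Bornology.IsBounded F} ∪
      {F ∈ D.faces | Bornology.IsBounded F} := by
    ext F
    simp only [Set.mem_union, Set.mem_ofPred_eq]
    tauto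
  constructor
  · rw [hun]
    exact (hsub.finite.union hfin).to_subtype
  · change D.faces.ncard ≤ _
    rw [hun]
    refine (Set.ncard_union_le _ _).trans (add_le_add ?_ ?_)
    · have := hsub.finite.to_subtype
      exact Set.ncard_le_one_iff_subsingleton.2 hsub
    · rw [Set.ncard_eq_toFinset_card _ hfin]
      exact hbdd _ (by simp)

end GraphDrawing

/-! ### Cyclic orders, ranks and the number of clusters -/

/-- The cyclic order of angles, read off from their representatives in `(-π, π]`. -/
theorem Real.Angle.sbtw_coe_iff {x y z : ℝ} (hx : x ∈ Set.Ioc (-Real.pi) Real.pi)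
    (hy : y ∈ Set.Ioc (-Real.pi) Real.pi) (hz : z ∈ Set.Ioc (-Real.pi) Real.pi) :
    sbtw (x : Real.Angle) (y : Real.Angle) (z : Real.Angle) ↔
      x < y ∧ y < z ∨ y < z ∧ z < x ∨ z < x ∧ x < y := by
  have hp : 0 < 2 * Real.pi := Real.two_pi_pos
  have : Fact (0 < 2 * Real.pi) := ⟨hp⟩
  have h : btw (z : Real.Angle) (y : Real.Angle) (x : Real.Angle) ↔
      toIcoMod hp z y ≤ toIocMod hp z x := QuotientAddGroup.btw_coe_iff
  rw [sbtw_iff_not_btw, h, not_le]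
  obtain ⟨hx1, hx2⟩ := hx
  obtain ⟨hy1, hy2⟩ := hy
  obtain ⟨hz1, hz2⟩ := hz
  have e1 : toIcoMod hp z y = if z ≤ y then y else y + 2 * Real.pi := by
    rw [toIcoMod_eq_iff]
    split_ifs with h
    · exact ⟨⟨h, by linarith⟩, 0, by simp⟩
    · exact ⟨⟨by linarith, by linarith⟩, -1, by simp⟩
  have e2 : toIocMod hp z x = if z < x then x else x + 2 * Real.pi := by
    rw [toIocMod_eq_iff]
    split_ifs with h
    · exact ⟨⟨h, by linarith⟩, 0, by simp⟩
    · exact ⟨⟨by linarith, by linarith⟩, -1, by simp⟩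
  rw [e1, e2]
  split_ifs with h1 h2 h2
  · constructor
    · exact fun h => Or.inr (Or.inr ⟨h1, h⟩)
    · rintro (h | h | h) <;> linarith
  · constructor
    · exact fun _ => Or.inr (Or.inl ⟨by linarith, h1⟩)
    · intro _; linarith
  · constructor
    · intro h; linarith
    · rintro (h | h | h) <;> linarith
  · constructor
    · exact fun h => Or.inl ⟨by linarith, by linarith⟩
    · rintro (h | h | h) <;> linarith

/-- The position of a value of a real function on a finite type among all its values. -/
noncomputable def valueRank {A : Type*} [Finite A] (f : A → ℝ) (a : A) : Fin (Nat.card A) :=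
  ⟨{b | f b < f a}.ncard, by
    rw [← Set.ncard_univ]
    exact Set.ncard_lt_ncard (Set.ssubset_univ_iff.2 fun h =>
      lt_irrefl (f a) (h.symm ▸ Set.mem_univ a : a ∈ {b | f b < f a}))⟩

theorem valueRank_lt_iff {A : Type*} [Finite A] (f : A → ℝ) (a b : A) :
    valueRank f a < valueRank f b ↔ f a < f b := by
  have mono : ∀ a b, f a ≤ f b → valueRank f a ≤ valueRank f b := fun a b h =>
    Set.ncard_le_ncard fun c (hc : f c < f a) => hc.trans_le h
  refine ⟨fun h => lt_of_not_ge fun h' => h.not_ge (mono _ _ h'), fun h => ?_⟩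
  refine Fin.lt_def.2 (Set.ncard_lt_ncard ?_)
  exact (Set.ssubset_iff_of_subset fun c (hc : f c < f a) => hc.trans h).2
    ⟨a, h, lt_irrefl (f a)⟩

theorem Nat.card_set_eq {A : Type*} [Finite A] : Nat.card (Set A) = 2 ^ Nat.card A := by
  have := Fintype.ofFinite A
  rw [Nat.card_eq_fintype_card, Fintype.card_set, Nat.card_eq_fintype_card]

namespace GraphDrawing

variable {U : Type*} {H : SimpleGraph U}

/-- Injectivity of the curve fixes the parameter of `z`, and the exit is the first meeting with the
circle after it. -/
theorem IsExit.unique {D : GraphDrawing H} {d : H.Dart} {z w w' : ℂ} {r : ℝ}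
    (h : D.IsExit d z r w) (h' : D.IsExit d z r w') : w = w' := by
  obtain ⟨s, t, hst, hs, rfl, hr, hq⟩ := h
  obtain ⟨s', t', hst', hs', rfl, hr', hq'⟩ := h'
  obtain rfl : s = s' := D.arc_injective d (hs.trans hs'.symm)
  rcases lt_trichotomy t t' with h | h | h
  · exact absurd hr (hq' t hst.le h).ne
  · rw [h]
  · exact absurd hr' (hq t' hst'.le h).ne

open Classical in
/-- The direction, seen from `z`, of the point where `d` first meets the circle of radius `r`
about `z`. -/
noncomputable def exitArg (D : GraphDrawing H) (z : ℂ) (r : ℝ) (d : H.Dart) : ℝ :=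
  if h : ∃ w, D.IsExit d z r w then (h.choose - z).arg else 0

theorem IsExit.exitArg_eq {D : GraphDrawing H} {d : H.Dart} {z w : ℂ} {r : ℝ}
    (h : D.IsExit d z r w) : D.exitArg z r d = (w - z).arg := by
  have h' : ∃ w, D.IsExit d z r w := ⟨w, h⟩
  rw [exitArg, dif_pos h', h'.choose_spec.unique h]

/-- Expresses the rotation by comparisons of real numbers, which `valueRank` preserves. The order is
reversed because arguments grow counterclockwise. -/
theorem clockwise_iff (D : GraphDrawing H) (z : ℂ) (r : ℝ) (d e f : H.Dart) :
    D.Clockwise z r d e f ↔ (∃ w, D.IsExit d z r w) ∧ (∃ w, D.IsExit e z r w) ∧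
      (∃ w, D.IsExit f z r w) ∧
      (D.exitArg z r f < D.exitArg z r e ∧ D.exitArg z r e < D.exitArg z r d ∨
        D.exitArg z r e < D.exitArg z r d ∧ D.exitArg z r d < D.exitArg z r f ∨
        D.exitArg z r d < D.exitArg z r f ∧ D.exitArg z r f < D.exitArg z r e) := by
  constructor
  · rintro ⟨a, b, c, ha, hb, hc, h⟩
    rw [Real.Angle.sbtw_coe_iff (Complex.arg_mem_Ioc _) (Complex.arg_mem_Ioc _)
      (Complex.arg_mem_Ioc _)] at h
    rw [ha.exitArg_eq, hb.exitArg_eq, hc.exitArg_eq]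
    exact ⟨⟨a, ha⟩, ⟨b, hb⟩, ⟨c, hc⟩, h⟩
  · rintro ⟨⟨a, ha⟩, ⟨b, hb⟩, ⟨c, hc⟩, h⟩
    rw [ha.exitArg_eq, hb.exitArg_eq, hc.exitArg_eq] at h
    refine ⟨a, b, c, ha, hb, hc, ?_⟩
    rwa [Real.Angle.sbtw_coe_iff (Complex.arg_mem_Ioc _) (Complex.arg_mem_Ioc _)
      (Complex.arg_mem_Ioc _)]

/-- The number of topological clusters with respect to `X` is at most `2 ^ k * 2 ^ k * k ^ k`. -/
theorem card_le_of_sameCluster_eq [Finite U] (D : GraphDrawing H) (X : Set U)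
    (h : ∀ s t, D.SameCluster X s t → s = t) :
    Xᶜ.ncard ≤ 2 ^ X.ncard * (2 ^ X.ncard * X.ncard ^ X.ncard) := by
  classical
  choose r hr using fun x => D.exists_admissibleRadius (D.pt x)
  let nbrs : U → Set X := fun x => {a | H.Adj x a}
  -- `Clockwise` requires the exits to exist. Recording for which neighbours they do costs a factor
  -- `2 ^ k` and avoids proving that they always do.
  let exits : U → Set X :=
    fun x => {a | ∃ h : H.Adj x a, ∃ w, D.IsExit ⟨(x, a), h⟩ (D.pt x) (r x) w}
  -- The value `0` at non-neighbours is harmless: only neighbours are compared, and equal ranks give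
  -- equal comparisons.
  let dir : U → X → ℝ :=
    fun x a => if h : H.Adj x a then D.exitArg (D.pt x) (r x) ⟨(x, a), h⟩ else 0
  let code : U → Set X × (Set X × (X → Fin (Nat.card X))) :=
    fun x => (nbrs x, exits x, valueRank (dir x))
  have key : ∀ x y, code x = code y → ∀ (a b c : X)
      (xa : H.Adj x a) (xb : H.Adj x b) (xc : H.Adj x c)
      (ya : H.Adj y a) (yb : H.Adj y b) (yc : H.Adj y c),
      D.Clockwise (D.pt x) (r x) ⟨(x, a), xa⟩ ⟨(x, b), xb⟩ ⟨(x, c), xc⟩ →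
        D.Clockwise (D.pt y) (r y) ⟨(y, a), ya⟩ ⟨(y, b), yb⟩ ⟨(y, c), yc⟩ := by
    intro x y hxy a b c xa xb xc ya yb yc
    have hex : exits x = exits y := congrArg (fun p => p.2.1) hxy
    have hrank : valueRank (dir x) = valueRank (dir y) := congrArg (fun p => p.2.2) hxy
    have hexit : ∀ (a : X) (xa : H.Adj x a) (ya : H.Adj y a),
        (∃ w, D.IsExit ⟨(x, a), xa⟩ (D.pt x) (r x) w) →
          ∃ w, D.IsExit ⟨(y, a), ya⟩ (D.pt y) (r y) w := by
      intro a xa ya hw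
      have hm : a ∈ exits x := ⟨xa, hw⟩
      rw [hex] at hm
      exact hm.2
    have hlt : ∀ (a b : X) (xa : H.Adj x a) (ya : H.Adj y a) (xb : H.Adj x b) (yb : H.Adj y b),
        D.exitArg (D.pt x) (r x) ⟨(x, a), xa⟩ < D.exitArg (D.pt x) (r x) ⟨(x, b), xb⟩ ↔
        D.exitArg (D.pt y) (r y) ⟨(y, a), ya⟩ < D.exitArg (D.pt y) (r y) ⟨(y, b), yb⟩ := by
      intro a b xa ya xb yb
      have h1 := (valueRank_lt_iff (dir x) a b).symm.trans
        (hrank ▸ valueRank_lt_iff (dir y) a b)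
      simpa only [dir, dif_pos xa, dif_pos xb, dif_pos ya, dif_pos yb] using h1
    rw [clockwise_iff, clockwise_iff, hlt c b xc yc xb yb, hlt b a xb yb xa ya,
      hlt a c xa ya xc yc]
    exact fun ⟨h1, h2, h3, h4⟩ => ⟨hexit a xa ya h1, hexit b xb yb h2, hexit c xc yc h3, h4⟩
  have hinj : Function.Injective fun x : (Xᶜ : Set U) => code x := by
    intro x y hxy
    refine Subtype.ext (h _ _ ⟨x.2, y.2, fun a ha => ?_, r x, r y, hr x, hr y, ?_⟩)
    · have hn : nbrs x = nbrs y := congrArg Prod.fst hxy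
      exact Set.ext_iff.1 hn ⟨a, ha⟩
    · intro a ha b hb c hc xa xb xc ya yb yc
      exact ⟨key x y hxy ⟨a, ha⟩ ⟨b, hb⟩ ⟨c, hc⟩ xa xb xc ya yb yc,
        key y x hxy.symm ⟨a, ha⟩ ⟨b, hb⟩ ⟨c, hc⟩ ya yb yc xa xb xc⟩
  have hc := Nat.card_le_card_of_injective _ hinj
  rwa [Nat.card_prod, Nat.card_prod, Nat.card_set_eq, Nat.card_fun, Nat.card_fin,
    Nat.card_coe_set_eq, Nat.card_coe_set_eq] at hc

end GraphDrawing

/-! ### Coding drawings by finite relations -/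

theorem exists_injective_fin {A : Type*} [Finite A] {B : ℕ} (h : Nat.card A ≤ B) :
    ∃ f : A → Fin B, Function.Injective f :=
  ⟨_, (Fin.castLE_injective h).comp (Finite.equivFin A).injective⟩

theorem exists_equiv_of_range_eq {A A' T : Type*} {f : A → T} {f' : A' → T}
    (hf : Function.Injective f) (hf' : Function.Injective f') (h : Set.range f = Set.range f') :
    ∃ e : A ≃ A', ∀ a, f' (e a) = f a :=
  ⟨(Equiv.ofInjective f hf).trans ((Equiv.setCongr h).trans (Equiv.ofInjective f' hf').symm),
    fun a => by
      rw [Equiv.trans_apply, Equiv.trans_apply, Equiv.apply_ofInjective_symm hf']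
      rfl⟩

/-- Injective numberings lose no information, so equal coded relations correspond under the matching
of equal numbers. -/
theorem mem_iff_of_image_eq {A A' T : Type*} {f : A → T} {f' : A' → T}
    (hf : Function.Injective f) (hf' : Function.Injective f') {s : Set A} {s' : Set A'}
    (h : f '' s = f' '' s') {a : A} {a' : A'} (ha : f' a' = f a) : a ∈ s ↔ a' ∈ s' := by
  rw [← hf.mem_set_image, ← hf'.mem_set_image, ha, h]

/-- The type of codes of drawings by relations between numbers below `B`; an edge with an
orientation is coded by the pair of its ends. -/
abbrev DrawingCode (B : ℕ) : Type :=
  Set (Fin B) × Set (Fin B) × Set (Fin B) × Set (Fin B × Fin B) × Set (Fin B × Fin B) ×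
    Set (Fin B × Fin B) ×
    Set (Fin B × (Fin B × Fin B) × (Fin B × Fin B)) ×
    Set ((Fin B × Fin B) × Fin B × Fin B) ×
    Set (Fin B × (Fin B × Fin B) × (Fin B × Fin B) × (Fin B × Fin B)) ×
    Set (Fin B) × Set (Fin B × Fin B) ×
    Set (Fin B × (Fin B × Fin B) × Fin B × Fin B)

/-- The code consists of twelve relations of arity at most `7`, a dart counting as two entries, so
the exponent is at most `12 * B ^ 7`. -/
theorem card_drawingCode_le {B : ℕ} (hB : 12 ≤ B) : Nat.card (DrawingCode B) ≤ 2 ^ B ^ 8 := by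
  have h : ∀ i ≤ 7, B ^ i ≤ B ^ 7 := fun i hi => Nat.pow_le_pow_right (by omega) hi
  have h1 := h 1 (by norm_num)
  have h2 := h 2 (by norm_num)
  have h4 := h 4 (by norm_num)
  have h5 := h 5 (by norm_num)
  have h8 : 12 * B ^ 7 ≤ B ^ 8 := by
    rw [pow_succ B 7, mul_comm]
    exact Nat.mul_le_mul_left _ hB
  simp only [Nat.card_prod, Nat.card_set_eq, Nat.card_fin, ← pow_add]
  refine Nat.pow_le_pow_right two_pos (le_trans (le_of_eq ?_)
    ((by omega : 4 * B ^ 1 + 4 * B ^ 2 + B ^ 4 + 2 * B ^ 5 + B ^ 7 ≤ 12 * B ^ 7).trans h8))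
  ring

namespace GraphDrawing

variable {U : Type*} {H : SimpleGraph U}

/-- A numbering of the vertices, nodes and faces of a drawing by numbers below `B`, with a choice
of a small circle around each node. -/
structure Numbering (D : GraphDrawing H) (B : ℕ) where
  vert : U → Fin B
  vert_injective : Function.Injective vert
  node : D.nodes → Fin B
  node_injective : Function.Injective node
  face : D.faces → Fin B
  face_injective : Function.Injective face
  radius : D.nodes → ℝ
  admissible : ∀ z : D.nodes, D.AdmissibleRadius z (radius z)

namespace Numbering

variable {D : GraphDrawing H} {B : ℕ}

/-- The code of a dart. -/
def dart (N : D.Numbering B) (d : H.Dart) : Fin B × Fin B := (N.vert d.fst, N.vert d.snd)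

theorem dart_injective (N : D.Numbering B) : Function.Injective N.dart := by
  intro d e h
  exact SimpleGraph.Dart.ext _ _ (Prod.ext (N.vert_injective (congrArg Prod.fst h))
    (N.vert_injective (congrArg Prod.snd h)))

/-- The code of a drawing with marked vertices. -/
def code (N : D.Numbering B) {A : Type*} (m : A → U) (ξ : A → Fin B) : DrawingCode B :=
  (Set.range N.vert, Set.range N.node, Set.range N.face,
    Prod.map N.vert N.vert '' {p | H.Adj p.1 p.2},
    Set.range fun a => (ξ a, N.vert (m a)),
    Prod.map N.node N.vert '' {p | (p.1 : ℂ) = D.pt p.2},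
    Prod.map N.node (Prod.map N.dart N.dart) '' {p | D.IsCrossing p.2.1 p.2.2 p.1},
    Prod.map N.dart (Prod.map N.node N.node) '' {p | D.Precedes p.1 p.2.1 p.2.2},
    Prod.map N.node (Prod.map N.dart (Prod.map N.dart N.dart)) ''
      {p | D.Clockwise p.1 (N.radius p.1) p.2.1 p.2.2.1 p.2.2.2},
    N.face '' {F | Bornology.IsBounded (F : Set ℂ)},
    Prod.map N.face N.node '' {p | (p.2 : ℂ) ∈ frontier (p.1 : Set ℂ)},
    Prod.map N.face (Prod.map N.dart (Prod.map N.node N.node)) ''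
      {p | D.openSegment p.2.1 p.2.2.1 p.2.2.2 ⊆ frontier (p.1 : Set ℂ)})

/-- Drawings with the same code are combinatorially equivalent. -/
theorem exists_combEquiv_of_code_eq {U' : Type*} {H' : SimpleGraph U'} {D' : GraphDrawing H'}
    (N : D.Numbering B) (N' : D'.Numbering B) {A : Type*} {m : A → U} {m' : A → U'}
    {ξ : A → Fin B} (hξ : Function.Injective ξ) (h : N.code m ξ = N'.code m' ξ) :
    ∃ φ : H ≃g H', (∀ a, φ (m a) = m' a) ∧ CombEquiv φ D D' := by
  simp only [code, Prod.mk.injEq] at h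
  obtain ⟨hv, hn, hf, hadj, hmark, hpt, hcross, hprec, hcw, hbdd, hfn, hfs⟩ := h
  obtain ⟨e, he⟩ := exists_equiv_of_range_eq N.vert_injective N'.vert_injective hv
  obtain ⟨β, hβ⟩ := exists_equiv_of_range_eq N.node_injective N'.node_injective hn
  obtain ⟨ψ, hψ⟩ := exists_equiv_of_range_eq N.face_injective N'.face_injective hf
  let φ : H ≃g H' := ⟨e, fun {u v} => (mem_iff_of_image_eq
    (N.vert_injective.prodMap N.vert_injective) (N'.vert_injective.prodMap N'.vert_injective) hadj
    (a := (u, v)) (a' := (e u, e v)) (by simp [he])).symm⟩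
  have hd : ∀ d : H.Dart, N'.dart (φ.toHom.mapDart d) = N.dart d := fun d =>
    Prod.ext (he d.fst) (he d.snd)
  refine ⟨φ, fun a => ?_, β, ψ, fun z u => ?_, fun z d d' => ?_, fun d w z => ?_, fun z => ?_,
    fun F => ?_, fun F z => ?_, fun F d w z _ => ?_⟩
  · obtain ⟨b, hb⟩ : (ξ a, N.vert (m a)) ∈ Set.range fun a => (ξ a, N'.vert (m' a)) :=
      hmark ▸ ⟨a, rfl⟩
    obtain ⟨hb1, hb2⟩ := Prod.mk.inj hb
    obtain rfl := hξ hb1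
    exact N'.vert_injective ((he _).trans hb2.symm)
  · exact mem_iff_of_image_eq (N.node_injective.prodMap N.vert_injective)
      (N'.node_injective.prodMap N'.vert_injective) hpt (a := (z, u)) (a' := (β z, e u))
      (by simp [he, hβ])
  · exact mem_iff_of_image_eq
      (N.node_injective.prodMap (N.dart_injective.prodMap N.dart_injective))
      (N'.node_injective.prodMap (N'.dart_injective.prodMap N'.dart_injective)) hcross
      (a := (z, d, d')) (a' := (β z, φ.toHom.mapDart d, φ.toHom.mapDart d'))
      (by simp only [Prod.map_apply, hd, hβ])
  · exact mem_iff_of_image_eq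
      (N.dart_injective.prodMap (N.node_injective.prodMap N.node_injective))
      (N'.dart_injective.prodMap (N'.node_injective.prodMap N'.node_injective)) hprec
      (a := (d, w, z)) (a' := (φ.toHom.mapDart d, β w, β z))
      (by simp only [Prod.map_apply, hd, hβ])
  -- The radii stored in the two numberings are those at which the coded rotations were read off.
  · refine ⟨_, _, N.admissible z, N'.admissible (β z), fun d d₁ d₂ _ _ _ => ?_⟩
    exact mem_iff_of_image_eq (N.node_injective.prodMap
        (N.dart_injective.prodMap (N.dart_injective.prodMap N.dart_injective)))
      (N'.node_injective.prodMap
        (N'.dart_injective.prodMap (N'.dart_injective.prodMap N'.dart_injective))) hcw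
      (a := (z, d, d₁, d₂))
      (a' := (β z, φ.toHom.mapDart d, φ.toHom.mapDart d₁, φ.toHom.mapDart d₂))
      (by simp only [Prod.map_apply, hd, hβ])
  · exact mem_iff_of_image_eq N.face_injective N'.face_injective hbdd (hψ F)
  · exact mem_iff_of_image_eq (N.face_injective.prodMap N.node_injective)
      (N'.face_injective.prodMap N'.node_injective) hfn (a := (F, z)) (a' := (ψ F, β z))
      (by simp [hψ, hβ])
  · exact mem_iff_of_image_eq (N.face_injective.prodMap
        (N.dart_injective.prodMap (N.node_injective.prodMap N.node_injective)))
      (N'.face_injective.prodMap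
        (N'.dart_injective.prodMap (N'.node_injective.prodMap N'.node_injective))) hfs
      (a := (F, d, w, z)) (a' := (ψ F, φ.toHom.mapDart d, β w, β z))
      (by simp only [Prod.map_apply, hd, hψ, hβ])

end Numbering

/-- The faces dictate the exponent `12`: with at most `n ^ 5` nodes and `n ^ 3` pieces there are at
most `1 + n ^ 11` of them. -/
theorem IsGood.nonempty_numbering [Finite U] {D : GraphDrawing H} (hD : D.IsGood) {n : ℕ}
    (hn : 2 ≤ n) (hU : Nat.card U ≤ n) : Nonempty (D.Numbering (n ^ 12)) := by
  obtain ⟨hfn, hcn⟩ := hD.finite_nodes_and_card_le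
  obtain ⟨hff, hcf⟩ := hD.finite_faces_and_card_le
  have h1 : Nat.card D.nodes ≤ n ^ 5 := calc
    _ ≤ n + (n * n) * (n * n) := hcn.trans (by gcongr)
    _ ≤ n ^ 4 + n ^ 4 := add_le_add (Nat.le_self_pow (by norm_num) n) (by ring_nf; rfl)
    _ = n ^ 4 * 2 := by ring
    _ ≤ n ^ 5 := by rw [pow_succ n 4]; gcongr
  have h2 : Nat.card D.pieces ≤ n ^ 3 := calc
    _ ≤ n + n * n := D.card_pieces_le.trans (by gcongr)
    _ ≤ n ^ 2 + n ^ 2 := add_le_add (Nat.le_self_pow (by norm_num) n) (by ring_nf; rfl)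
    _ = n ^ 2 * 2 := by ring
    _ ≤ n ^ 3 := by rw [pow_succ n 2]; gcongr
  have h3 : Nat.card D.faces ≤ n ^ 12 := calc
    _ ≤ 1 + n ^ 5 * (n ^ 3 * n ^ 3) := hcf.trans (by gcongr)
    _ ≤ n ^ 11 + n ^ 11 := add_le_add (Nat.one_le_pow _ _ (by omega)) (by ring_nf; rfl)
    _ = n ^ 11 * 2 := by ring
    _ ≤ n ^ 12 := by rw [pow_succ n 11]; gcongr
  obtain ⟨v, hv⟩ := exists_injective_fin (hU.trans (Nat.le_self_pow (by norm_num : 12 ≠ 0) n))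
  obtain ⟨m, hm⟩ := exists_injective_fin
    (h1.trans (Nat.pow_le_pow_right (by omega) (by norm_num : 5 ≤ 12)))
  obtain ⟨f, hf⟩ := exists_injective_fin h3
  choose r hr using fun z : D.nodes => D.exists_admissibleRadius z
  exact ⟨⟨v, hv, m, hm, f, hf, r, hr⟩⟩

end GraphDrawing

/-! ### Bounds for abstract topological clusterings -/

namespace AbstractClustering

variable {V : Type*} {G : SimpleGraph V} {X : Set V}

theorem ncard_verts_le [Finite V] (C : AbstractClustering G X) :
    C.verts.ncard ≤ max X.ncard 2 ^ (4 * max X.ncard 2) := by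
  have h := C.drawing.card_le_of_sameCluster_eq _ C.eq_of_sameCluster
  have hX : (Subtype.val ⁻¹' X : Set C.verts).ncard = X.ncard := by
    rw [← Set.ncard_image_of_injective _ Subtype.val_injective, Subtype.image_preimage_coe,
      Set.inter_eq_right.2 C.subset_verts]
  rw [hX] at h
  rw [← Nat.card_coe_set_eq, ← Set.ncard_add_ncard_compl (Subtype.val ⁻¹' X : Set C.verts), hX]
  generalize (Subtype.val ⁻¹' X : Set C.verts)ᶜ.ncard = m at h
  generalize X.ncard = k at h
  have hk : k ≤ max k 2 := le_max_left _ _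
  have h2 : 2 ≤ max k 2 := le_max_right _ _
  generalize max k 2 = K at hk h2
  have e1 : 2 ^ k ≤ K ^ K := (Nat.pow_le_pow_left h2 k).trans (Nat.pow_le_pow_right (by omega) hk)
  have e2 : k ^ k ≤ K ^ K := (Nat.pow_le_pow_left hk k).trans (Nat.pow_le_pow_right (by omega) hk)
  -- Each of the three factors of the cluster bound is at most `K ^ K`; the fourth `K` in the
  -- exponent absorbs the summand for `X`.
  calc k + m ≤ K + K ^ K * (K ^ K * K ^ K) := by
        refine add_le_add hk (h.trans ?_)
        gcongr
    _ = K + K ^ (3 * K) := by ring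
    _ ≤ K ^ (3 * K) + K ^ (3 * K) := by
        gcongr
        exact Nat.le_self_pow (by omega) K
    _ = K ^ (3 * K) * 2 := by ring
    _ ≤ K ^ (3 * K + 1) := by rw [pow_succ]; gcongr
    _ ≤ K ^ (4 * K) := Nat.pow_le_pow_right (by omega) (by omega)

/-- Pairwise non-equivalent clusterings on at most `n` vertices each have distinct codes. -/
theorem finite_and_ncard_le_of_pairwise [Finite V] {n : ℕ} (hn : 2 ≤ n)
    (hC : ∀ C : AbstractClustering G X, C.verts.ncard ≤ n) (S : Set (AbstractClustering G X))
    (hS : S.Pairwise fun C C' => ¬ C.Equivalent C') : S.Finite ∧ S.ncard ≤ 2 ^ (n ^ 12) ^ 8 := by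
  rcases S.eq_empty_or_nonempty with rfl | ⟨C₀, -⟩
  · simp
  have hX : Nat.card X ≤ n ^ 12 := (Set.ncard_le_ncard C₀.subset_verts).trans
    ((hC C₀).trans (Nat.le_self_pow (by norm_num) n))
  -- One labelling of `X` serves all clusterings, so that equal codes give isomorphisms fixing `X`
  -- pointwise.
  obtain ⟨ξ, hξ⟩ := exists_injective_fin hX
  have N : ∀ C : AbstractClustering G X, C.drawing.Numbering (n ^ 12) := fun C =>
    (C.isGood.nonempty_numbering hn (hC C)).some
  let code : AbstractClustering G X → DrawingCode (n ^ 12) := fun C =>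
    (N C).code (fun a : X => (⟨a, C.subset_verts a.2⟩ : C.verts)) ξ
  have hinj : Set.InjOn code S := by
    intro C h C' h' e
    by_contra hne
    obtain ⟨φ, hφ, hequiv⟩ := (N C).exists_combEquiv_of_code_eq (N C') hξ e
    exact hS h h' hne ⟨φ, fun v hv => congrArg Subtype.val (hφ ⟨v, hv⟩), hequiv⟩
  have hB : 12 ≤ n ^ 12 := by
    calc 12 ≤ 2 ^ 12 := by norm_num
      _ ≤ n ^ 12 := Nat.pow_le_pow_left hn 12
  refine ⟨Set.Finite.of_finite_image (Set.toFinite _) hinj, le_trans ?_ (card_drawingCode_le hB)⟩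
  rw [← Set.ncard_univ]
  exact Set.ncard_le_ncard_of_injOn code (fun _ _ => Set.mem_univ _) hinj

end AbstractClustering

theorem mainTheorem6 :
    ∃ c : ℕ, ∀ (V : Type*) [Finite V] (G : SimpleGraph V) (X : Set V) (k : ℕ),
      G.IsVertexCover X → X.ncard = k →
        (∀ C : AbstractClustering G X, C.verts.ncard ≤ max k 2 ^ (c * max k 2)) ∧
        (∀ S : Set (AbstractClustering G X),
          (S.Pairwise fun C C' => ¬ C.Equivalent C') →
            S.Finite ∧ S.ncard ≤ 2 ^ (max k 2 ^ (c * max k 2))) := by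
  -- `384 = 4 * 12 * 8`, from the exponents of the bounds on vertices (`4 * K`), numbers (`12`) and
  -- codes (`8`).
  refine ⟨384, fun V _ G X k _ hk => ?_⟩
  subst hk
  have hK : 2 ≤ max X.ncard 2 := le_max_right _ _
  constructor
  · exact fun C => C.ncard_verts_le.trans
      (Nat.pow_le_pow_right (by omega) (Nat.mul_le_mul_right _ (by norm_num)))
  · intro S hS
    have h := AbstractClustering.finite_and_ncard_le_of_pairwise
      (hK.trans (Nat.le_self_pow (by omega) _)) AbstractClustering.ncard_verts_le S hS
    rwa [← pow_mul, ← pow_mul, show 4 * max X.ncard 2 * (12 * 8) = 384 * max X.ncard 2 by ring]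
      at h
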